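/- Call a nonempty convex polytope $P \subset \mathbb{R}^d$ an *ideal hyperbolic polytope* (in the projective disk model) if it is contained in the closed unit ball and all its vertices lie on the unit sphere $S^{d-1}$. For $c \in \mathbb{R}^d$ let $P^c$ denote the face of $P$ on which the linear function $x \mapsto \langle c, x\rangle$ attains its maximum over $P$. Two polytopes $Q, Q' \subset \mathbb{R}^d$ are *normally equivalent* if for every $c \in \mathbb{R}^d$ the affine hulls of $Q^c$ and $Q'^c$ differ by a translation. Let $Q, Q' \subset \mathbb{R}^d$ be normally equivalent ideal hyperbolic polytopes that are not of the degenerate form $Q = \{x\}$, $Q' = \{-x\}$. Call the linear function $x\mapsto\langle c, x\rangle$ generic if it has a unique maximizer $q$ over $Q$ and a unique maximizer $q'$ over $Q'$. Then generic linear functions exist, and the angle between $q$ and $q'$ is one and the same number $\theta = \theta(Q,Q') \in [0,\pi)$ for all generic linear functions. Moreover, $$\frac{1}{\sqrt{2 + 2\cos\theta(Q,Q')}}\,(Q + Q')$$ is again an ideal hyperbolic polytope, where $Q+Q'=\{x+x' : x\in Q,\ x'\in Q'\}$ is the Minkowski sum. -/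

import Mathlib

open scoped Pointwise

namespace IdealSum

/-- A (nonempty) convex polytope in `ℝ^d`: the convex hull of a nonempty finite set of points. -/
def IsPolytope {d : ℕ} (P : Set (EuclideanSpace ℝ (Fin d))) : Prop :=
  ∃ s : Set (EuclideanSpace ℝ (Fin d)), s.Finite ∧ s.Nonempty ∧ P = convexHull ℝ s

/-- The face `P^c` of `P`: the points of `P` maximizing the linear function `x ↦ ⟨c, x⟩`. -/
def maxFace {d : ℕ} (P : Set (EuclideanSpace ℝ (Fin d))) (c : EuclideanSpace ℝ (Fin d)) :
    Set (EuclideanSpace ℝ (Fin d)) :=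
  {x | x ∈ P ∧ ∀ y ∈ P, inner ℝ c y ≤ inner ℝ c x}

/-- `P` and `P'` are normally equivalent: for every `c`, the affine hulls of the faces `P^c` and
`P'^c` differ by a translation (this is what `AffineSubspace.Parallel` says). -/
def NormallyEquivalent {d : ℕ} (P P' : Set (EuclideanSpace ℝ (Fin d))) : Prop :=
  ∀ c : EuclideanSpace ℝ (Fin d),
    (affineSpan ℝ (maxFace P c)).Parallel (affineSpan ℝ (maxFace P' c))

/-- An ideal hyperbolic polytope in the projective disk (Beltrami-Klein) model: a polytope
contained in the closed unit ball all of whose vertices lie on the unit sphere. -/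
structure IsIdealPolytope {d : ℕ} (P : Set (EuclideanSpace ℝ (Fin d))) : Prop where
  isPolytope : IsPolytope P
  subset_closedBall : P ⊆ Metric.closedBall 0 1
  vertices_subset_sphere : P.extremePoints ℝ ⊆ Metric.sphere 0 1

/-- The linear function `x ↦ ⟨c, x⟩` is generic for `Q` and `Q'`, and `q`, `q'` are the unique
points (hence vertices) maximizing it over `Q` and over `Q'`, respectively. -/
def AreMaximizers {d : ℕ} (Q Q' : Set (EuclideanSpace ℝ (Fin d)))
    (c q q' : EuclideanSpace ℝ (Fin d)) : Prop :=
  maxFace Q c = {q} ∧ maxFace Q' c = {q'}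

end IdealSum

/-!
In normally equivalent polytopes every vertex `v` of `P` has a corresponding vertex `v'` of `P'`
with the same maximizing functionals, and an edge of `P` from `v` to `w` corresponds to a parallel
edge of `P'` from `v'` to `w'`. If all vertices lie on spheres centred at the origin, then `w - v`
is orthogonal to `w + v` and `w' - v'` to `w' + v'`; as the two differences are parallel, each is
orthogonal to both sums, which gives `⟨v, v'⟩ = ⟨w, w'⟩`. The graph of a polytope is connected (by
the simplex method), so `⟨v, v'⟩` is constant, and for unit spheres so is the angle `θ` between `v`
and `v'`. Each vertex of the Minkowski sum is such a `v + v'`, whose norm is `√(2 + 2 cos θ)`. If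
`θ = π`, then `v' = -v` throughout, and a generic functional attains its maximum and its minimum
over `P` at the same vertex, which forces `P` and `P'` to be antipodal points.
-/

namespace IdealSum

section VectorSpace

variable {E : Type*} [AddCommGroup E] [Module ℝ E]

theorem not_sameRay_sub_of_mem_extremePoints {P : Set E} {u v w : E} (hu : u ∈ P.extremePoints ℝ)
    (hv : v ∈ P) (hw : w ∈ P.extremePoints ℝ) (huv : u ≠ v) (hwv : w ≠ v) (huw : u ≠ w) :
    ¬ SameRay ℝ (u - v) (w - v) := by
  rw [mem_extremePoints_iff_forall_segment] at hu hw
  rw [← vsub_eq_sub, ← vsub_eq_sub]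
  intro h
  rcases wbtw_total_of_sameRay_vsub_left h with h | h
  · exact (hu.2 v hv w hw.1 (mem_segment_iff_wbtw.2 h)).elim huv.symm huw.symm
  · exact (hw.2 v hv u hu.1 (mem_segment_iff_wbtw.2 h)).elim hwv.symm huw

end VectorSpace

section InnerProductSpace

variable {E : Type*} [NormedAddCommGroup E] [InnerProductSpace ℝ E]

theorem inner_eq_inner_of_sub_eq_smul_sub {v w v' w' : E} {μ : ℝ} (hμ : μ ≠ 0)
    (hvw : ‖v‖ = ‖w‖) (hvw' : ‖v'‖ = ‖w'‖) (h : w' - v' = μ • (w - v)) :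
    inner ℝ v v' = inner ℝ w w' := by
  have hperp : inner ℝ (w + v) (w' - v') = 0 := by
    rw [h, inner_smul_right, (real_inner_add_sub_eq_zero_iff w v).2 hvw.symm, mul_zero]
  have hperp' : inner ℝ (w' + v') (w - v) = 0 := by
    have := (real_inner_add_sub_eq_zero_iff w' v').2 hvw'.symm
    rw [h, inner_smul_right] at this
    exact (mul_eq_zero.1 this).resolve_left hμ
  rw [real_inner_comm] at hperp'
  simp only [inner_add_left, inner_add_right, inner_sub_left, inner_sub_right] at hperp hperp'
  linarith

theorem dense_setOf_forall_inner_ne_zero {S : Set E} (hS : S.Finite) (h0 : 0 ∉ S) :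
    Dense {c : E | ∀ x ∈ S, inner ℝ c x ≠ 0} := by
  have hopen (x : E) : IsOpen {c : E | inner ℝ c x ≠ 0} :=
    isOpen_ne_fun (continuous_id.inner continuous_const) continuous_const
  have hdense : ∀ x ∈ S, Dense {c : E | inner ℝ c x ≠ 0} := fun x hx => by
    have hx0 : innerSL ℝ x ≠ 0 := fun h =>
      h0 (innerSL_inj.1 (h.trans (map_zero _).symm) ▸ hx)
    simpa [Set.preimage, real_inner_comm] using
      (dense_compl_singleton (0 : ℝ)).preimage ((innerSL ℝ x).isOpenMap_of_ne_zero hx0)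
  convert (hS.image fun x => {c : E | inner ℝ c x ≠ 0}).dense_sInter
    (Set.forall_mem_image.2 fun x _ => hopen x) (Set.forall_mem_image.2 hdense) using 1
  ext c
  simp

theorem norm_add_eq_sqrt_of_norm_eq_one {x y : E} (hx : ‖x‖ = 1) (hy : ‖y‖ = 1) :
    ‖x + y‖ = √(2 + 2 * Real.cos (InnerProductGeometry.angle x y)) := by
  rw [← InnerProductGeometry.inner_eq_cos_angle_of_norm_eq_one hx hy,
    ← Real.sqrt_sq (norm_nonneg (x + y)), norm_add_sq_real, hx, hy]
  ring_nf

theorem eq_neg_of_angle_eq_pi {x y : E} (hx : ‖x‖ = 1) (hy : ‖y‖ = 1)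
    (h : InnerProductGeometry.angle x y = Real.pi) : y = -x := by
  rw [eq_neg_iff_add_eq_zero, add_comm, ← eq_neg_iff_add_eq_zero,
    ← inner_eq_neg_one_iff_of_norm_eq_one (𝕜 := ℝ) hx hy,
    InnerProductGeometry.inner_eq_cos_angle_of_norm_eq_one hx hy, h, Real.cos_pi]

end InnerProductSpace

variable {d : ℕ} {P P' : Set (EuclideanSpace ℝ (Fin d))}
  {c c₀ c₁ v v' w w' : EuclideanSpace ℝ (Fin d)}

section MaxFace

theorem isExposed_maxFace : IsExposed ℝ P (maxFace P c) :=
  fun _ => ⟨innerSL ℝ c, rfl⟩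

theorem mem_extremePoints_of_maxFace_eq_singleton (h : maxFace P c = {v}) :
    v ∈ P.extremePoints ℝ :=
  (h ▸ isExposed_maxFace).isExtreme.mem_extremePoints

theorem mem_maxFace_of_maxFace_eq_singleton (h : maxFace P c = {v}) : v ∈ maxFace P c :=
  h ▸ Set.mem_singleton v

theorem mem_maxFace_of_inner_le (hv : v ∈ maxFace P c) (hw : w ∈ P)
    (h : inner ℝ c v ≤ inner ℝ c w) : w ∈ maxFace P c :=
  ⟨hw, fun y hy => (hv.2 y hy).trans h⟩

theorem inner_eq_of_mem_maxFace (hv : v ∈ maxFace P c) (hw : w ∈ maxFace P c) :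
    inner ℝ c v = inner ℝ c w :=
  (hw.2 v hv.1).antisymm (hv.2 w hw.1)

theorem maxFace_add : maxFace (P + P') c = maxFace P c + maxFace P' c := by
  ext x
  constructor
  · rintro ⟨⟨p, hp, p', hp', rfl⟩, hmax⟩
    refine Set.add_mem_add ⟨hp, fun y hy => ?_⟩ ⟨hp', fun y hy => ?_⟩
    · simpa [inner_add_right] using hmax _ (Set.add_mem_add hy hp')
    · simpa [inner_add_right] using hmax _ (Set.add_mem_add hp hy)
  · rintro ⟨p, hp, p', hp', rfl⟩
    refine ⟨Set.add_mem_add hp.1 hp'.1, ?_⟩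
    rintro _ ⟨y, hy, y', hy', rfl⟩
    simpa only [inner_add_right] using add_le_add (hp.2 y hy) (hp'.2 y' hy')

theorem maxFace_add_smul_eq_singleton {t : ℝ} (ht : 0 ≤ t) (h₀ : maxFace P c₀ = {v})
    (h : v ∈ maxFace P c) : maxFace P (c₀ + t • c) = {v} := by
  have hv := mem_maxFace_of_maxFace_eq_singleton h₀
  have hle : ∀ y ∈ P, t * inner ℝ c y ≤ t * inner ℝ c v := fun y hy =>
    mul_le_mul_of_nonneg_left (h.2 y hy) ht
  have hmem : v ∈ maxFace P (c₀ + t • c) := ⟨h.1, fun y hy => by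
    simpa only [inner_add_left, real_inner_smul_left] using add_le_add (hv.2 y hy) (hle y hy)⟩
  refine Set.eq_singleton_iff_unique_mem.2 ⟨hmem, fun y hy => ?_⟩
  have heq := inner_eq_of_mem_maxFace hmem hy
  simp only [inner_add_left, real_inner_smul_left] at heq
  exact h₀.subset (mem_maxFace_of_inner_le hv hy.1 (by linarith [hle y hy.1]))

end MaxFace

namespace IsPolytope

theorem convex (hP : IsPolytope P) : Convex ℝ P := by
  obtain ⟨s, -, -, rfl⟩ := hP
  exact convex_convexHull ℝ s

theorem isCompact (hP : IsPolytope P) : IsCompact P := by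
  obtain ⟨s, hs, -, rfl⟩ := hP
  exact hs.isCompact_convexHull ℝ

theorem nonempty (hP : IsPolytope P) : P.Nonempty := by
  obtain ⟨s, -, hs, rfl⟩ := hP
  exact hs.convexHull

theorem finite_extremePoints (hP : IsPolytope P) : (P.extremePoints ℝ).Finite := by
  obtain ⟨s, hs, -, rfl⟩ := hP
  exact hs.subset extremePoints_convexHull_subset

theorem convexHull_extremePoints_inter_maxFace (hP : IsPolytope P) :
    convexHull ℝ (P.extremePoints ℝ ∩ maxFace P c) = maxFace P c := by
  have hface : IsExposed ℝ P (maxFace P c) := isExposed_maxFace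
  refine (convexHull_min Set.inter_subset_right (hface.convex hP.convex)).antisymm ?_
  rw [← ((hP.finite_extremePoints.inter_of_left _).isClosed_convexHull ℝ).closure_eq]
  calc maxFace P c
      = closure (convexHull ℝ ((maxFace P c).extremePoints ℝ)) :=
        (closure_convexHull_extremePoints (hface.isCompact hP.isCompact)
          (hface.convex hP.convex)).symm
    _ ⊆ closure (convexHull ℝ (P.extremePoints ℝ ∩ maxFace P c)) :=
        closure_mono <| convexHull_mono <| Set.subset_inter
          hface.isExtreme.extremePoints_subset_extremePoints extremePoints_subset

theorem convexHull_extremePoints (hP : IsPolytope P) :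
    convexHull ℝ (P.extremePoints ℝ) = P := by
  have hzero : maxFace P 0 = P := by simp [maxFace]
  simpa only [hzero, Set.inter_eq_left.2 extremePoints_subset] using
    hP.convexHull_extremePoints_inter_maxFace (c := 0)

theorem subset_iff_extremePoints_subset (hP : IsPolytope P)
    {K : Set (EuclideanSpace ℝ (Fin d))} (hK : Convex ℝ K) :
    P ⊆ K ↔ P.extremePoints ℝ ⊆ K :=
  ⟨extremePoints_subset.trans, fun h =>
    hP.convexHull_extremePoints.superset.trans (convexHull_min h hK)⟩

theorem mem_maxFace_iff (hP : IsPolytope P) :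
    v ∈ maxFace P c ↔ v ∈ P ∧ ∀ u ∈ P.extremePoints ℝ, inner ℝ c u ≤ inner ℝ c v :=
  and_congr_right fun _ => hP.subset_iff_extremePoints_subset <|
    convex_halfSpace_le (innerSL ℝ c).isLinear (inner ℝ c v)

theorem maxFace_eq_singleton_iff (hP : IsPolytope P) : maxFace P c = {v} ↔
    v ∈ P ∧ ∀ u ∈ P.extremePoints ℝ, u ≠ v → inner ℝ c u < inner ℝ c v := by
  constructor
  · intro h
    have hv := mem_maxFace_of_maxFace_eq_singleton h
    refine ⟨hv.1, fun u hu huv => lt_of_not_ge fun hle => huv ?_⟩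
    exact h.subset (mem_maxFace_of_inner_le hv hu.1 hle)
  · rintro ⟨hv, hlt⟩
    have hvmax : v ∈ maxFace P c := hP.mem_maxFace_iff.2 ⟨hv, fun u hu =>
      (eq_or_ne u v).elim (fun h => h ▸ le_rfl) fun h => (hlt u hu h).le⟩
    refine Set.Subset.antisymm ?_ (Set.singleton_subset_iff.2 hvmax)
    rw [← hP.convexHull_extremePoints_inter_maxFace]
    refine convexHull_min (fun u hu => ?_) (convex_singleton v)
    by_contra huv
    exact (hlt u hu.1 huv).not_ge (hu.2.2 v hv)

theorem isOpen_setOf_maxFace_eq_singleton (hP : IsPolytope P) (hv : v ∈ P) :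
    IsOpen {c | maxFace P c = {v}} := by
  have heq : {c | maxFace P c = {v}} =
      ⋂ u ∈ P.extremePoints ℝ \ {v}, {c | inner ℝ c u < inner ℝ c v} := by
    ext c
    simp [hP.maxFace_eq_singleton_iff, hv]
  rw [heq]
  exact hP.finite_extremePoints.sdiff.isOpen_biInter fun u _ =>
    isOpen_lt (continuous_id.inner continuous_const) (continuous_id.inner continuous_const)

theorem exists_maxFace_eq_singleton (hP : IsPolytope P) (hv : v ∈ P.extremePoints ℝ) :
    ∃ c, maxFace P c = {v} := by
  have hv' : v ∉ convexHull ℝ (P.extremePoints ℝ \ {v}) := fun h =>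
    (hP.convex.mem_extremePoints_iff_mem_sdiff_convexHull_sdiff.1 hv).2 <|
      convexHull_mono (Set.sdiff_subset_sdiff_left extremePoints_subset) h
  obtain ⟨f, r, hf, hr⟩ := geometric_hahn_banach_closed_point (convex_convexHull ℝ _)
    (hP.finite_extremePoints.sdiff.isClosed_convexHull ℝ) hv'
  obtain ⟨c, rfl⟩ := (InnerProductSpace.toDual ℝ _).surjective f
  exact ⟨c, hP.maxFace_eq_singleton_iff.2 ⟨hv.1, fun u hu huv =>
    (hf u (subset_convexHull ℝ _ ⟨hu, huv⟩)).trans hr⟩⟩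

theorem add (hP : IsPolytope P) (hP' : IsPolytope P') : IsPolytope (P + P') := by
  obtain ⟨s, hs, hne, rfl⟩ := hP
  obtain ⟨s', hs', hne', rfl⟩ := hP'
  exact ⟨s + s', hs.add hs', hne.add hne', (convexHull_add s s').symm⟩

theorem smul (hP : IsPolytope P) (r : ℝ) : IsPolytope (r • P) := by
  obtain ⟨s, hs, hne, rfl⟩ := hP
  exact ⟨r • s, hs.smul_set, hne.smul_set, (convexHull_smul r s).symm⟩

/-- The ratio test of the simplex method: `t` is the least of the ratios
`⟨c₀, v - u⟩ / ⟨c, u - v⟩` over the vertices `u` that are better for `c` than `v`. -/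
theorem exists_pivot (hP : IsPolytope P) (h₀ : v ∈ maxFace P c₀) (h : v ∉ maxFace P c) :
    ∃ t : ℝ, 0 ≤ t ∧ v ∈ maxFace P (c₀ + t • c) ∧
      ∃ w ∈ P.extremePoints ℝ, w ∈ maxFace P (c₀ + t • c) ∧ inner ℝ c v < inner ℝ c w := by
  have hbetter : {u ∈ P.extremePoints ℝ | inner ℝ c v < inner ℝ c u}.Nonempty := by
    by_contra! hempty
    exact h <| hP.mem_maxFace_iff.2 ⟨h₀.1, fun u hu => le_of_not_gt fun hlt =>
      Set.eq_empty_iff_forall_notMem.1 hempty u ⟨hu, hlt⟩⟩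
  obtain ⟨w, ⟨hw, hcw⟩, hmin⟩ := Set.exists_min_image _
    (fun u => (inner ℝ c₀ v - inner ℝ c₀ u) / (inner ℝ c u - inner ℝ c v))
    (hP.finite_extremePoints.sep _) hbetter
  set t := (inner ℝ c₀ v - inner ℝ c₀ w) / (inner ℝ c w - inner ℝ c v)
  have ht : 0 ≤ t := div_nonneg (sub_nonneg.2 (h₀.2 w hw.1)) (sub_pos.2 hcw).le
  have htie : t * (inner ℝ c w - inner ℝ c v) = inner ℝ c₀ v - inner ℝ c₀ w :=
    div_mul_cancel₀ _ (sub_pos.2 hcw).ne'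
  have hv : v ∈ maxFace P (c₀ + t • c) := by
    refine hP.mem_maxFace_iff.2 ⟨h₀.1, fun u hu => ?_⟩
    simp only [inner_add_left, real_inner_smul_left]
    rcases lt_or_ge (inner ℝ c v) (inner ℝ c u) with hlt | hge
    · linarith [(le_div_iff₀ (sub_pos.2 hlt)).1 (hmin u ⟨hu, hlt⟩)]
    · linarith [mul_le_mul_of_nonneg_left hge ht, h₀.2 u hu.1]
  refine ⟨t, ht, hv, w, hw, mem_maxFace_of_inner_le hv hw.1 ?_, hcw⟩
  simp only [inner_add_left, real_inner_smul_left]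
  linarith

/-- For a generic objective `c₀` the ratios in `exists_pivot` are pairwise distinct, so that the
pivot takes place along an edge. -/
theorem exists_maxFace_eq_singleton_slopes_ne (hP : IsPolytope P) (hv : v ∈ P.extremePoints ℝ)
    (c : EuclideanSpace ℝ (Fin d)) :
    ∃ c₀, maxFace P c₀ = {v} ∧ ∀ u ∈ P.extremePoints ℝ, ∀ w ∈ P.extremePoints ℝ, u ≠ w →
      0 < inner ℝ c (u - v) → 0 < inner ℝ c (w - v) →
      inner ℝ c (u - v) * inner ℝ c₀ (w - v) ≠ inner ℝ c (w - v) * inner ℝ c₀ (u - v) := by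
  set A := {u ∈ P.extremePoints ℝ | 0 < inner ℝ c (u - v)}
  set S := (fun p : EuclideanSpace ℝ (Fin d) × EuclideanSpace ℝ (Fin d) =>
    (inner ℝ c (p.1 - v) : ℝ) • (p.2 - v) - (inner ℝ c (p.2 - v) : ℝ) • (p.1 - v)) '' A.offDiag
  have hS : S.Finite := (hP.finite_extremePoints.sep _).offDiag.image _
  have hne : ∀ u ∈ A, u ≠ v := by
    rintro _ hu rfl
    simpa using hu.2
  have h0 : 0 ∉ S := by
    rintro ⟨⟨u, w⟩, ⟨hu, hw, huw⟩, h⟩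
    exact not_sameRay_sub_of_mem_extremePoints hu.1 hv.1 hw.1 (hne u hu) (hne w hw) huw
      (.inr (.inr ⟨_, _, hw.2, hu.2, (sub_eq_zero.1 h).symm⟩))
  obtain ⟨c₀, hc₀S, hc₀⟩ := (dense_setOf_forall_inner_ne_zero hS h0).exists_mem_open
    (hP.isOpen_setOf_maxFace_eq_singleton hv.1) (hP.exists_maxFace_eq_singleton hv)
  refine ⟨c₀, hc₀, fun u hu w hw huw hcu hcw h => ?_⟩
  refine hc₀S _ ⟨(u, w), ⟨⟨hu, hcu⟩, ⟨hw, hcw⟩, huw⟩, rfl⟩ ?_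
  simp only [inner_sub_right c₀ (_ • _), inner_smul_right, h, sub_self]

end IsPolytope

/-- Adjacency in the graph (1-skeleton) of `P`: the edges are the faces `P^e` that are segments
between two distinct vertices. -/
structure IsAdjacent (P : Set (EuclideanSpace ℝ (Fin d))) (v w : EuclideanSpace ℝ (Fin d)) :
    Prop where
  left_mem : v ∈ P.extremePoints ℝ
  right_mem : w ∈ P.extremePoints ℝ
  ne : v ≠ w
  exists_maxFace_eq : ∃ e, maxFace P e = segment ℝ v w

namespace IsPolytope

theorem exists_isAdjacent_inner_lt (hP : IsPolytope P) (hv : v ∈ P.extremePoints ℝ)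
    (hc : v ∉ maxFace P c) : ∃ w, IsAdjacent P v w ∧ inner ℝ c v < inner ℝ c w := by
  obtain ⟨c₀, hc₀, hslopes⟩ := hP.exists_maxFace_eq_singleton_slopes_ne hv c
  obtain ⟨t, ht, hve, w, hw, hwe, hlt⟩ :=
    hP.exists_pivot (mem_maxFace_of_maxFace_eq_singleton hc₀) hc
  have hvw : v ≠ w := fun h => hlt.ne (by rw [h])
  have htie : ∀ u ∈ maxFace P (c₀ + t • c), inner ℝ c₀ (u - v) = -(t * inner ℝ c (u - v)) :=
    fun u hu => by
      have := inner_eq_of_mem_maxFace hu hve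
      simp only [inner_add_left, real_inner_smul_left, inner_sub_right] at this ⊢
      linarith
  have hbetter : ∀ u ∈ P.extremePoints ℝ, u ∈ maxFace P (c₀ + t • c) → u ≠ v →
      0 < inner ℝ c (u - v) := fun u hu hue huv => by
    have hneg : inner ℝ c₀ (u - v) < 0 := by
      rw [inner_sub_right]
      exact sub_neg.2 ((hP.maxFace_eq_singleton_iff.1 hc₀).2 u hu huv)
    rw [htie u hue, neg_lt_zero] at hneg
    exact pos_of_mul_pos_right hneg ht
  have hvertices : P.extremePoints ℝ ∩ maxFace P (c₀ + t • c) = {v, w} := by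
    refine Set.Subset.antisymm (fun u hu => ?_)
      (Set.insert_subset ⟨hv, hve⟩ (Set.singleton_subset_iff.2 ⟨hw, hwe⟩))
    by_contra! hnot
    obtain ⟨huv, huw⟩ : u ≠ v ∧ u ≠ w := by simpa using hnot
    refine hslopes u hu.1 w hw huw (hbetter u hu.1 hu.2 huv) (hbetter w hw hwe hvw.symm) ?_
    rw [htie u hu.2, htie w hwe]
    ring
  refine ⟨w, ⟨hv, hw, hvw, c₀ + t • c, ?_⟩, hlt⟩
  rw [← hP.convexHull_extremePoints_inter_maxFace, hvertices, convexHull_pair]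

theorem reflTransGen_isAdjacent (hP : IsPolytope P) (hv : v ∈ P.extremePoints ℝ)
    (hw : w ∈ P.extremePoints ℝ) : Relation.ReflTransGen (IsAdjacent P) v w := by
  obtain ⟨c, hc⟩ := hP.exists_maxFace_eq_singleton hw
  obtain ⟨x, ⟨hx, hvx⟩, hmax⟩ := Set.exists_max_image
    {x ∈ P.extremePoints ℝ | Relation.ReflTransGen (IsAdjacent P) v x} (fun x => inner ℝ c x)
    (hP.finite_extremePoints.sep _) ⟨v, hv, .refl⟩
  have hxc : x ∈ maxFace P c := by
    by_contra hxc
    obtain ⟨y, hxy, hlt⟩ := hP.exists_isAdjacent_inner_lt hx hxc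
    exact (hmax y ⟨hxy.right_mem, hvx.tail hxy⟩).not_gt hlt
  rw [hc] at hxc
  exact hxc ▸ hvx

end IsPolytope

namespace NormallyEquivalent

theorem symm (h : NormallyEquivalent P P') : NormallyEquivalent P' P :=
  fun c => (h c).symm

theorem exists_areMaximizers (h : NormallyEquivalent P P') (hc : maxFace P c = {v}) :
    ∃ v', AreMaximizers P P' c v v' := by
  obtain ⟨x, hx⟩ := h c
  rw [hc, AffineSubspace.map_span, Set.image_singleton, AffineEquiv.coe_toAffineMap,
    AffineEquiv.constVAdd_apply] at hx
  have hne : (maxFace P' c).Nonempty := by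
    rw [← affineSpan_nonempty ℝ, hx]
    exact (affineSpan_nonempty ℝ).2 (Set.singleton_nonempty _)
  refine ⟨x +ᵥ v, hc, hne.subset_singleton_iff.1 ?_⟩
  simpa only [hx, AffineSubspace.coe_affineSpan_singleton] using
    subset_affineSpan ℝ (maxFace P' c)

end NormallyEquivalent

namespace AreMaximizers

theorem symm (h : AreMaximizers P P' c v v') : AreMaximizers P' P c v' v :=
  And.symm h

theorem left_mem_extremePoints (h : AreMaximizers P P' c v v') : v ∈ P.extremePoints ℝ :=
  mem_extremePoints_of_maxFace_eq_singleton h.1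

theorem right_mem_extremePoints (h : AreMaximizers P P' c v v') : v' ∈ P'.extremePoints ℝ :=
  h.symm.left_mem_extremePoints

theorem right_mem_maxFace (hP' : IsPolytope P') (h : NormallyEquivalent P P')
    (h₀ : AreMaximizers P P' c₀ v v') (hv : v ∈ maxFace P c) : v' ∈ maxFace P' c := by
  by_contra hv'
  obtain ⟨t, ht, hv't, w, -, hwt, hlt⟩ :=
    hP'.exists_pivot (mem_maxFace_of_maxFace_eq_singleton h₀.2) hv'
  obtain ⟨x, -, hx⟩ := h.exists_areMaximizers (maxFace_add_smul_eq_singleton ht h₀.1 hv)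
  rw [hx, Set.mem_singleton_iff] at hv't hwt
  exact hlt.ne (by rw [hv't, hwt])

theorem right_unique (hP' : IsPolytope P') (h : NormallyEquivalent P P')
    (h₀ : AreMaximizers P P' c₀ v v') (h₁ : AreMaximizers P P' c₁ v w') : v' = w' :=
  h₁.2.subset (h₀.right_mem_maxFace hP' h (mem_maxFace_of_maxFace_eq_singleton h₁.1))

theorem inner_eq_of_isAdjacent (hP : IsPolytope P) (hP' : IsPolytope P')
    (h : NormallyEquivalent P P') (h₀ : AreMaximizers P P' c₀ v v')
    (h₁ : AreMaximizers P P' c₁ w w') (hvw : IsAdjacent P v w) (hnorm : ‖v‖ = ‖w‖)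
    (hnorm' : ‖v'‖ = ‖w'‖) : inner ℝ v v' = inner ℝ w w' := by
  obtain ⟨e, he⟩ := hvw.exists_maxFace_eq
  have hv' : v' ∈ maxFace P' e :=
    h₀.right_mem_maxFace hP' h (he ▸ left_mem_segment ℝ v w)
  have hw' : w' ∈ maxFace P' e :=
    h₁.right_mem_maxFace hP' h (he ▸ right_mem_segment ℝ v w)
  have hparallel : w' - v' ∈ vectorSpan ℝ {v, w} := by
    rw [← direction_affineSpan, ← affineSpan_convexHull, convexHull_pair, ← he,
      direction_affineSpan, (h e).vectorSpan_eq]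
    exact vsub_mem_vectorSpan ℝ hw' hv'
  obtain ⟨μ, hμ⟩ := mem_vectorSpan_pair_rev.1 hparallel
  rw [vsub_eq_sub] at hμ
  have hμ0 : μ ≠ 0 := by
    rintro rfl
    obtain rfl : w' = v' := sub_eq_zero.1 (by rw [← hμ, zero_smul])
    exact hvw.ne (h₀.symm.right_unique hP h.symm h₁.symm)
  exact inner_eq_inner_of_sub_eq_smul_sub hμ0 hnorm hnorm' hμ.symm

theorem inner_eq {r r' : ℝ} (hP : IsPolytope P) (hP' : IsPolytope P')
    (hr : P.extremePoints ℝ ⊆ Metric.sphere 0 r) (hr' : P'.extremePoints ℝ ⊆ Metric.sphere 0 r')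
    (h : NormallyEquivalent P P') (h₀ : AreMaximizers P P' c₀ v v')
    (h₁ : AreMaximizers P P' c₁ w w') : inner ℝ v v' = inner ℝ w w' := by
  have hnorm {x y} (hx : x ∈ P.extremePoints ℝ) (hy : y ∈ P.extremePoints ℝ) : ‖x‖ = ‖y‖ := by
    rw [mem_sphere_zero_iff_norm.1 (hr hx), mem_sphere_zero_iff_norm.1 (hr hy)]
  have hnorm' {x y} (hx : x ∈ P'.extremePoints ℝ) (hy : y ∈ P'.extremePoints ℝ) : ‖x‖ = ‖y‖ := by
    rw [mem_sphere_zero_iff_norm.1 (hr' hx), mem_sphere_zero_iff_norm.1 (hr' hy)]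
  have hpath := hP.reflTransGen_isAdjacent h₀.left_mem_extremePoints h₁.left_mem_extremePoints
  induction hpath generalizing c₁ w' with
  | refl => rw [h₀.right_unique hP' h h₁]
  | tail _ hxw ih =>
    obtain ⟨e, he⟩ := hP.exists_maxFace_eq_singleton hxw.left_mem
    obtain ⟨x', hx⟩ := h.exists_areMaximizers he
    exact (ih hx).trans <| hx.inner_eq_of_isAdjacent hP hP' h h₁ hxw
      (hnorm hxw.left_mem hxw.right_mem)
      (hnorm' hx.right_mem_extremePoints h₁.right_mem_extremePoints)

end AreMaximizers

theorem exists_areMaximizers_of_mem_extremePoints_add (hP : IsPolytope P) (hP' : IsPolytope P')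
    {x : EuclideanSpace ℝ (Fin d)} (hx : x ∈ (P + P').extremePoints ℝ) :
    ∃ c v v', AreMaximizers P P' c v v' ∧ v + v' = x := by
  obtain ⟨c, hc⟩ := (hP.add hP').exists_maxFace_eq_singleton hx
  rw [maxFace_add] at hc
  obtain ⟨v, hv, v', hv', rfl⟩ := hc.superset rfl
  refine ⟨c, v, v', ⟨?_, ?_⟩, rfl⟩
  · exact Set.eq_singleton_iff_unique_mem.2 ⟨hv, fun y hy =>
      add_right_cancel (hc.subset (Set.add_mem_add hy hv'))⟩
  · exact Set.eq_singleton_iff_unique_mem.2 ⟨hv', fun y hy =>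
      add_left_cancel (hc.subset (Set.add_mem_add hv hy))⟩

theorem NormallyEquivalent.exists_areMaximizers_of_isPolytope (h : NormallyEquivalent P P')
    (hP : IsPolytope P) : ∃ c v v', AreMaximizers P P' c v v' := by
  obtain ⟨v, hv⟩ := hP.isCompact.extremePoints_nonempty hP.nonempty
  obtain ⟨c, hc⟩ := hP.exists_maxFace_eq_singleton hv
  exact ⟨c, v, h.exists_areMaximizers hc⟩

theorem NormallyEquivalent.eq_singleton_of_forall_eq_neg (hP : IsPolytope P)
    (h : NormallyEquivalent P P')
    (hneg : ∀ c v v', AreMaximizers P P' c v v' → v' = -v) (h₀ : AreMaximizers P P' c₀ v v') :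
    P = {v} := by
  refine hP.nonempty.subset_singleton_iff.1 <|
    (hP.subset_iff_extremePoints_subset (convex_singleton v)).2 fun w hw => ?_
  obtain ⟨c₁, hc₁⟩ := hP.exists_maxFace_eq_singleton hw
  obtain ⟨w', hw'⟩ := h.exists_areMaximizers hc₁
  have hle : inner ℝ c₀ w' ≤ inner ℝ c₀ v' :=
    (mem_maxFace_of_maxFace_eq_singleton h₀.2).2 w' hw'.right_mem_extremePoints.1
  rw [hneg _ _ _ h₀, hneg _ _ _ hw', inner_neg_right, inner_neg_right, neg_le_neg_iff] at hle
  exact h₀.1.subset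
    (mem_maxFace_of_inner_le (mem_maxFace_of_maxFace_eq_singleton h₀.1) hw.1 hle)

theorem IsIdealPolytope.norm_eq_one (hP : IsIdealPolytope P) (hv : v ∈ P.extremePoints ℝ) :
    ‖v‖ = 1 :=
  mem_sphere_zero_iff_norm.1 (hP.vertices_subset_sphere hv)

theorem IsPolytope.isIdealPolytope_inv_smul {r : ℝ} (hP : IsPolytope P) (hr : 0 < r)
    (h : P.extremePoints ℝ ⊆ Metric.sphere 0 r) : IsIdealPolytope (r⁻¹ • P) := by
  have hvertices : (r⁻¹ • P).extremePoints ℝ ⊆ Metric.sphere 0 1 := by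
    have himage : r⁻¹ • P =
        LinearEquiv.smulOfNeZero ℝ (EuclideanSpace ℝ (Fin d)) r⁻¹ (inv_pos.2 hr).ne' '' P := rfl
    rw [himage, ← image_extremePoints]
    rintro _ ⟨x, hx, rfl⟩
    rw [mem_sphere_zero_iff_norm, LinearEquiv.smulOfNeZero_apply, norm_smul,
      mem_sphere_zero_iff_norm.1 (h hx), Real.norm_of_nonneg (inv_pos.2 hr).le,
      inv_mul_cancel₀ hr.ne']
  exact ⟨hP.smul r⁻¹, ((hP.smul r⁻¹).subset_iff_extremePoints_subset
    (convex_closedBall 0 1)).2 (hvertices.trans Metric.sphere_subset_closedBall), hvertices⟩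

theorem AreMaximizers.angle_eq (hP : IsIdealPolytope P) (hP' : IsIdealPolytope P')
    (h : NormallyEquivalent P P') (h₀ : AreMaximizers P P' c₀ v v')
    (h₁ : AreMaximizers P P' c₁ w w') :
    InnerProductGeometry.angle v v' = InnerProductGeometry.angle w w' := by
  simp only [InnerProductGeometry.angle, hP.norm_eq_one h₀.left_mem_extremePoints,
    hP.norm_eq_one h₁.left_mem_extremePoints, hP'.norm_eq_one h₀.right_mem_extremePoints,
    hP'.norm_eq_one h₁.right_mem_extremePoints, h₀.inner_eq hP.isPolytope hP'.isPolytope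
    hP.vertices_subset_sphere hP'.vertices_subset_sphere h h₁]

theorem NormallyEquivalent.exists_eq_singleton_of_forall_angle_eq_pi (hP : IsIdealPolytope P)
    (hP' : IsIdealPolytope P') (h : NormallyEquivalent P P')
    (hpi : ∀ c v v', AreMaximizers P P' c v v' → InnerProductGeometry.angle v v' = Real.pi) :
    ∃ x, P = {x} ∧ P' = {-x} := by
  have hneg : ∀ c v v', AreMaximizers P P' c v v' → v' = -v := fun c v v' hv =>
    eq_neg_of_angle_eq_pi (hP.norm_eq_one hv.left_mem_extremePoints)
      (hP'.norm_eq_one hv.right_mem_extremePoints) (hpi c v v' hv)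
  obtain ⟨c, v, v', hv⟩ := h.exists_areMaximizers_of_isPolytope hP.isPolytope
  refine ⟨v, h.eq_singleton_of_forall_eq_neg hP.isPolytope hneg hv, ?_⟩
  rw [← hneg c v v' hv]
  exact h.symm.eq_singleton_of_forall_eq_neg hP'.isPolytope
    (fun c w' w hw => by rw [hneg c w w' hw.symm, neg_neg]) hv.symm

end IdealSum

theorem corollary1p4 {d : ℕ} (Q Q' : Set (EuclideanSpace ℝ (Fin d)))
    (hQ : IdealSum.IsIdealPolytope Q) (hQ' : IdealSum.IsIdealPolytope Q')
    (hQQ' : IdealSum.NormallyEquivalent Q Q')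
    -- the degenerate case of two antipodal one-point sets (where the angle would be `π`)
    (hne : ¬ ∃ x : EuclideanSpace ℝ (Fin d), Q = {x} ∧ Q' = {-x}) :
    ∃ θ ∈ Set.Ico 0 Real.pi,
      (∃ c q q' : EuclideanSpace ℝ (Fin d), IdealSum.AreMaximizers Q Q' c q q') ∧
      (∀ c q q' : EuclideanSpace ℝ (Fin d), IdealSum.AreMaximizers Q Q' c q q' →
        InnerProductGeometry.angle q q' = θ) ∧
      IdealSum.IsIdealPolytope ((1 / Real.sqrt (2 + 2 * Real.cos θ)) • (Q + Q')) := by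
  obtain ⟨c, p, p', hp⟩ := hQQ'.exists_areMaximizers_of_isPolytope hQ.isPolytope
  have hangle : ∀ c q q' : EuclideanSpace ℝ (Fin d), IdealSum.AreMaximizers Q Q' c q q' →
      InnerProductGeometry.angle q q' = InnerProductGeometry.angle p p' :=
    fun _ _ _ hq => hq.angle_eq hQ hQ' hQQ' hp
  have hlt : InnerProductGeometry.angle p p' < Real.pi :=
    (InnerProductGeometry.angle_le_pi p p').lt_of_ne fun hpi =>
      hne <| hQQ'.exists_eq_singleton_of_forall_angle_eq_pi hQ hQ' fun c q q' hq =>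
        (hangle c q q' hq).trans hpi
  have hcos : -1 < Real.cos (InnerProductGeometry.angle p p') := by
    rw [← Real.cos_pi]
    exact Real.cos_lt_cos_of_nonneg_of_le_pi (InnerProductGeometry.angle_nonneg p p') le_rfl hlt
  refine ⟨_, ⟨InnerProductGeometry.angle_nonneg p p', hlt⟩, ⟨c, p, p', hp⟩, hangle, ?_⟩
  rw [one_div]
  refine (hQ.isPolytope.add hQ'.isPolytope).isIdealPolytope_inv_smul
    (Real.sqrt_pos.2 (by linarith)) fun x hx => ?_
  obtain ⟨c, q, q', hq, rfl⟩ := IdealSum.exists_areMaximizers_of_mem_extremePoints_add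
    hQ.isPolytope hQ'.isPolytope hx
  rw [mem_sphere_zero_iff_norm, ← hangle c q q' hq, IdealSum.norm_add_eq_sqrt_of_norm_eq_one
    (hQ.norm_eq_one hq.left_mem_extremePoints) (hQ'.norm_eq_one hq.right_mem_extremePoints)]
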